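/- **Definitions.** Let $N\ge 1$, let $D\subset\mathbb R^N$ be open and let $K\ge 1$. A Lebesgue measurable function $u:D\to[-\infty,+\infty)$ is *$K$-quasinearly subharmonic* if $u^+\in L^1_{\mathrm{loc}}(D)$ and, for every closed ball $\overline{B^N(x,r)}\subset D$ and every $M\ge 0$, $$u_M(x)\le \frac{K}{\nu_N r^N}\int_{B^N(x,r)}u_M(y)\,dm_N(y),\qquad u_M:=\max\{u,-M\}+M,$$ where $m_N$ is Lebesgue measure and $\nu_N=m_N(B^N(0,1))$. The function $u$ is *quasinearly subharmonic* if it is $K$-quasinearly subharmonic for some $K\ge 1$. **Corollary 4.3.** Let $K\ge 1$, let $m\ge n\ge 2$, let $\Omega$ be a domain in $\mathbb R^{m+n}$ and let $u:\Omega\to[-\infty,+\infty)$ be Lebesgue measurable. For $y\in\mathbb R^n$ put $\Omega(y)=\{x\in\mathbb R^m:(x,y)\in\Omega\}$, and for $x\in\mathbb R^m$ put $\Omega(x)=\{y\in\mathbb R^n:(x,y)\in\Omega\}$. Suppose that (a) for each $y\in\mathbb R^n$ the function $\Omega(y)\ni x\mapsto u(x,y)$ is $K$-quasinearly subharmonic;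 (b) for each $x\in\mathbb R^m$ the function $\Omega(x)\ni y\mapsto u(x,y)$ is $K$-quasinearly subharmonic; (c) there are strictly increasing surjections $\varphi,\phi:[0,+\infty)\to[0,+\infty)$ and $s_0,s_1\in\mathbb N$ with $s_0<s_1$ such that - (c1) $2K\,\phi^{-1}(e^{s-s_0})\le \phi^{-1}(e^{s})$ for all real $s\ge s_1$; - (c2) $\phi^{-1}$ satisfies a $\Delta_2$-condition: there are constants $C,t_0\ge 0$ such that $\phi^{-1}(2t)\le C\,\phi^{-1}(t)$ for all $t\ge t_0$; - (c3) $\displaystyle\int_{s_1}^{+\infty}\frac{s^{\frac{n-1}{m-1}}}{\varphi(s-s_0)^{\frac1{m-1}}}\,ds<+\infty$; - (c4) $\varphi\circ\log^+\phi(u^+)\in L^1_{\mathrm{loc}}(\Omega)$, where $\log^+ t=\max\{\log t,0\}$ for $t>0$ and $\log^+0=0$. Then $u$ is quasinearly subharmonic in $\Omega$. -/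

import Mathlib

open MeasureTheory Metric
open scoped NNReal

namespace QNS

/-- Euclidean space `ℝ^N`. -/
abbrev Eucl (N : ℕ) : Type := EuclideanSpace ℝ (Fin N)

/-- The point `(x, y)` of `ℝ^{m+n}` for `x ∈ ℝ^m` and `y ∈ ℝ^n`. -/
def join {m n : ℕ} (x : Eucl m) (y : Eucl n) : Eucl (m + n) :=
  WithLp.toLp 2 (Fin.append (fun i => x i) (fun j => y j))

/-- The positive part `u⁺ = max {u, 0}`, real-valued where `u < +∞`. -/
noncomputable def uplus {N : ℕ} (u : Eucl N → EReal) (x : Eucl N) : ℝ :=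
  (max (u x) 0).toReal

/-- The function `u_M = max {u, -M} + M`, real-valued where `u < +∞`. -/
noncomputable def trunc {N : ℕ} (u : Eucl N → EReal) (M : ℝ) (x : Eucl N) : ℝ :=
  (max (u x) ((-M : ℝ) : EReal)).toReal + M

/-- `u : D → [-∞, +∞)` is `K`-quasinearly subharmonic on the open set `D ⊆ ℝ^N`.
Only the values of `u` on `D` matter. (`AEMeasurable` with respect to Lebesgue measure on `D` is
Lebesgue measurability on `D`.) -/
structure IsKQuasinearlySubharmonic {N : ℕ} (K : ℝ) (D : Set (Eucl N))
    (u : Eucl N → EReal) : Prop where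
  one_le : 1 ≤ K
  lt_top : ∀ x ∈ D, u x < ⊤
  measurable : AEMeasurable u (volume.restrict D)
  locallyIntegrable : LocallyIntegrableOn (uplus u) D volume
  mean_value : ∀ (x : Eucl N) (r : ℝ), 0 < r → closedBall x r ⊆ D → ∀ M : ℝ, 0 ≤ M →
    trunc u M x ≤ K / volume.real (ball x r) * ∫ y in ball x r, trunc u M y

/-- `u` is quasinearly subharmonic on `D`: it is `K`-quasinearly subharmonic for some `K ≥ 1`. -/
def IsQuasinearlySubharmonic {N : ℕ} (D : Set (Eucl N)) (u : Eucl N → EReal) : Prop :=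
  ∃ K : ℝ, IsKQuasinearlySubharmonic K D u

/-- The `Δ₂`-condition `f (2t) ≤ C f t`, required for large `t` only (so it is implied by the
`Δ₂`-condition for all `t ≥ 0`). -/
def DeltaTwo (f : ℝ≥0 → ℝ≥0) : Prop :=
  ∃ C t₀ : ℝ≥0, ∀ t : ℝ≥0, t₀ ≤ t → f (2 * t) ≤ C * f t

end QNS

namespace QNS

/-! Two steps: `u⁺` is locally bounded, and a separately quasinearly subharmonic function that is
locally bounded above is jointly quasinearly subharmonic. The second is soft: the mean value
inequalities over two balls of radius `r/2` are iterated, and the product of these balls lies in the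
ball of radius `r`.

The first rests on Domar's method. Each slice of `u⁺` is locally bounded, but with a bound that
varies with the slice, so a bound depending only on integral data is required. For levels `T i`
growing in a controlled way, a value above `T (i + s₀)` at `x` forces either a large portion of the
band `T i < f ≤ T (i + s₀ + 1)` near `x`, or a value above `T (i + s₀ + 1)` at distance less than a
radius `R i`. If the `R i` can be chosen with small sum, the chain of ever larger values stays in a
fixed ball, contradicting boundedness of the slice. This is `le_of_mean_value_of_summable`, whose
bound does not involve the slice's own bound.

In `bounded_of_separately_mean_value` the criterion is applied twice. In `x`, it shows that a high
value of `h x y` forces the slice integral of `G` at `y` to be large. These slice integrals then act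
as the majorant in `y`, with weights that are powers of tails of the first weights. Their
summability is the Hardy-type inequality `summable_tail_rpow`, and its hypothesis is what (c3)
provides for the levels `ϕ⁻¹(e^(J+i))`; (c1) and (c2) control the growth of these levels, and (c4)
makes the majorant integrable. -/

open Filter Topology

/-! ### Product coordinates on `ℝ^{m+n}` -/

/-- `join` as a linear isometry from the `L²`-product. -/
noncomputable def joinIso (m n : ℕ) : WithLp 2 (Eucl m × Eucl n) ≃ₗᵢ[ℝ] Eucl (m + n) :=
  ((LinearIsometryEquiv.piLpCongrLeft 2 ℝ ℝ finSumFinEquiv.symm).trans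
    (PiLp.sumPiLpEquivProdLpPiLp 2 _)).symm

theorem joinIso_toLp {m n : ℕ} (p : Eucl m × Eucl n) :
    joinIso m n (WithLp.toLp 2 p) = join p.1 p.2 := by
  rw [joinIso, LinearIsometryEquiv.symm_apply_eq]
  apply WithLp.ofLp_injective
  refine Prod.ext ?_ ?_
  · ext i
    simp [join, LinearIsometryEquiv.piLpCongrLeft, PiLp.sumPiLpEquivProdLpPiLp]
  · ext i
    simp [join, LinearIsometryEquiv.piLpCongrLeft, PiLp.sumPiLpEquivProdLpPiLp]

theorem measurePreserving_join (m n : ℕ) :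
    MeasurePreserving (fun p : Eucl m × Eucl n => join p.1 p.2) := by
  have h := (joinIso m n).measurePreserving.comp (WithLp.volume_preserving_toLp (Eucl m) (Eucl n))
  convert h using 1
  ext1 p
  exact (joinIso_toLp p).symm

theorem measurableEmbedding_join (m n : ℕ) :
    MeasurableEmbedding (fun p : Eucl m × Eucl n => join p.1 p.2) := by
  have h := (joinIso m n).toHomeomorph.measurableEmbedding.comp
    (MeasurableEquiv.toLp 2 (Eucl m × Eucl n)).measurableEmbedding
  convert h using 1
  ext1 p
  exact (joinIso_toLp p).symm

theorem continuous_join (m n : ℕ) :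
    Continuous (fun p : Eucl m × Eucl n => join p.1 p.2) := by
  have h := (joinIso m n).continuous.comp (WithLp.prod_continuous_toLp 2 (Eucl m) (Eucl n))
  exact h.congr fun p => joinIso_toLp p

theorem exists_join_eq {m n : ℕ} (z : Eucl (m + n)) : ∃ x y, join (m := m) (n := n) x y = z := by
  refine ⟨((joinIso m n).symm z).ofLp.1, ((joinIso m n).symm z).ofLp.2, ?_⟩
  rw [← joinIso_toLp (_, _)]
  exact (joinIso m n).apply_symm_apply z

theorem dist_join_sq {m n : ℕ} (x x' : Eucl m) (y y' : Eucl n) :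
    dist (join x y) (join x' y') ^ 2 = dist x x' ^ 2 + dist y y' ^ 2 := by
  rw [← joinIso_toLp (x, y), ← joinIso_toLp (x', y'), LinearIsometryEquiv.dist_map,
    WithLp.prod_dist_eq_of_L2]
  exact Real.sq_sqrt (by positivity)

theorem dist_join_le {m n : ℕ} (x x' : Eucl m) (y y' : Eucl n) :
    dist (join x y) (join x' y') ≤ dist x x' + dist y y' := by
  refine abs_le_of_sq_le_sq' ?_ (by positivity) |>.2
  rw [dist_join_sq]
  nlinarith [dist_nonneg (x := x) (y := x'), dist_nonneg (x := y) (y := y')]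

/-! ### Domar's method in one variable -/

theorem volume_real_ball {N : ℕ} (x : Eucl N) {r : ℝ} (hr : 0 < r) :
    volume.real (ball x r) = r ^ N * volume.real (ball (0 : Eucl N) 1) := by
  rw [measureReal_def, Measure.addHaar_ball_of_pos volume x hr, ENNReal.toReal_mul,
    ENNReal.toReal_ofReal (by positivity), finrank_euclideanSpace_fin, measureReal_def]

theorem volume_real_unitBall_pos (N : ℕ) : 0 < volume.real (ball (0 : Eucl N) 1) :=
  ENNReal.toReal_pos (measure_ball_pos _ _ one_pos).ne' measure_ball_lt_top.ne

/-- Split the ball at height `a`: the part where `f ≤ a` contributes at most `K * a ≤ b / 2` to the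
mean value bound, and the rest at most `K * d * |E| / |ball| ≤ b / 2`. -/
theorem le_of_mean_value_of_measure_level_le {N : ℕ} {f : Eucl N → ℝ} {K C R a b d : ℝ}
    {x : Eucl N} {U : Set (Eucl N)} (hU : volume U ≠ ⊤) (hK : 1 ≤ K) (hR : 0 < R)
    (hRU : ball x R ⊆ U) (hf0 : ∀ y, 0 ≤ f y) (hfm : AEMeasurable f (volume.restrict U))
    (hmv : f x ≤ K / volume.real (ball x R) * ∫ y in ball x R, f y)
    (ha : 0 ≤ a) (hab : 2 * K * a ≤ b) (hb : 0 < b) (hd : ∀ y ∈ ball x R, f y ≤ d)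
    (hdb : d ≤ C * b)
    (hsmall : 2 * K * C * (volume.restrict U).real {y | a < f y ∧ f y ≤ d} ≤
      R ^ N * volume.real (ball (0 : Eucl N) 1)) : f x ≤ b := by
  set E := {y | a < f y ∧ f y ≤ d} with hE
  have hd0 : 0 ≤ d := (hf0 x).trans (hd x (mem_ball_self hR))
  have hfin : (volume.restrict U) E ≠ ⊤ :=
    ne_top_of_le_ne_top (by simpa using hU) (measure_mono (Set.subset_univ E))
  have hle : (volume.restrict (ball x R)) ≤ volume.restrict U :=
    Measure.restrict_mono_set _ hRU
  have hint : ∫ y in ball x R, f y ≤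
      a * volume.real (ball x R) + d * (volume.restrict U).real E := by
    rw [integral_eq_lintegral_of_nonneg_ae (Eventually.of_forall hf0)
      (hfm.mono_measure hle).aestronglyMeasurable]
    apply ENNReal.toReal_le_of_le_ofReal (by positivity)
    calc ∫⁻ y in ball x R, ENNReal.ofReal (f y)
        ≤ ∫⁻ y in ball x R, (ENNReal.ofReal a + E.indicator (fun _ => ENNReal.ofReal d) y) := by
          refine setLIntegral_mono' measurableSet_ball fun y hy => ?_
          by_cases h : a < f y
          · rw [Set.indicator_of_mem (show y ∈ E from ⟨h, hd y hy⟩)]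
            exact (ENNReal.ofReal_le_ofReal (hd y hy)).trans le_add_self
          · exact (ENNReal.ofReal_le_ofReal (not_lt.1 h)).trans le_self_add
      _ = ENNReal.ofReal a * volume (ball x R) +
          ∫⁻ y in ball x R, E.indicator (fun _ => ENNReal.ofReal d) y := by
          rw [lintegral_add_left measurable_const, setLIntegral_const]
      _ ≤ ENNReal.ofReal a * volume (ball x R) +
          ENNReal.ofReal d * (volume.restrict U) E := by
          gcongr
          exact (lintegral_indicator_const_le _ _).trans (mul_le_mul_right (hle E) _)
      _ = _ := by
          rw [ENNReal.ofReal_add (by positivity) (by positivity), ENNReal.ofReal_mul ha,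
            ENNReal.ofReal_mul hd0, ofReal_measureReal hfin,
            ofReal_measureReal measure_ball_lt_top.ne]
  rw [← volume_real_ball x hR] at hsmall
  have hV : 0 < volume.real (ball x R) := by
    rw [volume_real_ball x hR]
    have := volume_real_unitBall_pos N
    positivity
  set V := volume.real (ball x R)
  set e := (volume.restrict U).real E
  have he : 0 ≤ e := measureReal_nonneg
  refine hmv.trans ?_
  rw [div_mul_eq_mul_div, div_le_iff₀ hV]
  have h1 : K * (∫ y in ball x R, f y) ≤ K * (a * V + d * e) := by gcongr
  have h2 : d * e ≤ C * b * e := by gcongr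
  have h3 : K * (d * e) ≤ K * (C * b * e) := by gcongr
  have h4 : 2 * K * a * V ≤ b * V := by gcongr
  have h5 : 2 * K * C * e * b ≤ V * b := by gcongr
  linarith

/-- The bands overlap at most `s₀ + 1` times: if `i₀` is the least index whose band contains `x`,
then `T i < f x ≤ T (i₀ + s₀ + 1)` forces `i < i₀ + s₀ + 1` for every other such `i`. -/
theorem sum_indicator_levels_le {X : Type*} {f : X → ℝ} {T : ℕ → ℝ} (hT : Monotone T) (s₀ k : ℕ)
    (W : ℕ → ENNReal) (x : X) (a : ENNReal) (ha : ∀ i, T i < f x → W i ≤ a) :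
    ∑ i ∈ Finset.range k, {y | T i < f y ∧ f y ≤ T (i + s₀ + 1)}.indicator (fun _ => W i) x ≤
      (s₀ + 1) * a := by
  classical
  set F := (Finset.range k).filter fun i => T i < f x ∧ f x ≤ T (i + s₀ + 1) with hF
  have h1 : ∑ i ∈ Finset.range k,
      {y | T i < f y ∧ f y ≤ T (i + s₀ + 1)}.indicator (fun _ => W i) x = ∑ i ∈ F, W i := by
    simp only [hF, Finset.sum_filter, Set.indicator_apply, Set.mem_ofPred_eq]
  have hcard : F.card ≤ s₀ + 1 := by
    rcases F.eq_empty_or_nonempty with h | h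
    · simp [h]
    · have hsub : F ⊆ Finset.Ico (F.min' h) (F.min' h + s₀ + 1) := by
        intro i hi
        have h0 := (Finset.mem_filter.1 (F.min'_mem h)).2.2
        have h1 := (Finset.mem_filter.1 hi).2.1
        exact Finset.mem_Ico.2 ⟨F.min'_le i hi, hT.reflect_lt (h1.trans_le h0)⟩
      refine (Finset.card_le_card hsub).trans ?_
      simp [add_assoc]
  rw [h1]
  calc ∑ i ∈ F, W i ≤ F.card • a :=
        Finset.sum_le_card_nsmul _ _ _ fun i hi => ha i (Finset.mem_filter.1 hi).2.1
    _ ≤ _ := by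
        rw [nsmul_eq_mul]
        gcongr
        exact_mod_cast hcard

/-- A Chebyshev estimate on all bands at once, by integrating the overlap bound. No measurability of
`g` is needed, which matters when `g` is itself a slice integral. -/
theorem sum_measure_levels_le {X : Type*} [MeasurableSpace X] {μ : Measure X} [IsFiniteMeasure μ]
    {f : X → ℝ} (hf : AEMeasurable f μ) {T : ℕ → ℝ} (hT : Monotone T) (s₀ k : ℕ)
    {W : ℕ → ℝ} (hW : ∀ i, 0 ≤ W i) {g : X → ENNReal}
    (hg : ∀ᵐ x ∂μ, ∀ i, T i < f x → ENNReal.ofReal (W i) ≤ g x) {A : ℝ} (hA0 : 0 ≤ A)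
    (hA : ∫⁻ x, g x ∂μ ≤ ENNReal.ofReal A) :
    ∑ i ∈ Finset.range k, W i * μ.real {y | T i < f y ∧ f y ≤ T (i + s₀ + 1)} ≤
      (s₀ + 1) * A := by
  have hE : ∀ i, NullMeasurableSet {y | T i < f y ∧ f y ≤ T (i + s₀ + 1)} μ := fun i =>
    hf.nullMeasurable (measurableSet_Ioc (a := T i) (b := T (i + s₀ + 1)))
  rw [← ENNReal.ofReal_le_ofReal_iff (by positivity), ENNReal.ofReal_sum_of_nonneg
    fun i _ => mul_nonneg (hW i) measureReal_nonneg]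
  calc ∑ i ∈ Finset.range k,
        ENNReal.ofReal (W i * μ.real {y | T i < f y ∧ f y ≤ T (i + s₀ + 1)})
      = ∑ i ∈ Finset.range k, ∫⁻ x, {y | T i < f y ∧ f y ≤ T (i + s₀ + 1)}.indicator
          (fun _ => ENNReal.ofReal (W i)) x ∂μ := by
        refine Finset.sum_congr rfl fun i _ => ?_
        rw [ENNReal.ofReal_mul (hW i), ofReal_measureReal, lintegral_indicator_const₀ (hE i)]
    _ = ∫⁻ x, ∑ i ∈ Finset.range k, {y | T i < f y ∧ f y ≤ T (i + s₀ + 1)}.indicator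
          (fun _ => ENNReal.ofReal (W i)) x ∂μ := by
        rw [lintegral_finsetSum']
        exact fun i _ => aemeasurable_const.indicator₀ (hE i)
    _ ≤ ∫⁻ x, (s₀ + 1) * g x ∂μ := by
        refine lintegral_mono_ae (hg.mono fun x hx => ?_)
        exact sum_indicator_levels_le hT s₀ k _ x _ hx
    _ = (s₀ + 1) * ∫⁻ x, g x ∂μ := lintegral_const_mul' _ _ (by finiteness)
    _ ≤ _ := by
        rw [ENNReal.ofReal_mul (by positivity)]
        gcongr
        rw [ENNReal.ofReal_add (by positivity) zero_le_one]
        simp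

/-- `f` is nonnegative, measurable and bounded on the ball of centre `x₀` and radius `ρ`, and
satisfies there the mean value inequality with constant `K`. -/
structure IsBoundedMeanValue {N : ℕ} (K : ℝ) (f : Eucl N → ℝ) (x₀ : Eucl N) (ρ : ℝ) : Prop where
  nonneg : ∀ x, 0 ≤ f x
  aemeasurable : AEMeasurable f (volume.restrict (ball x₀ ρ))
  bounded : ∃ B, ∀ x ∈ closedBall x₀ ρ, f x ≤ B
  mean_value : ∀ x r, 0 < r → closedBall x r ⊆ closedBall x₀ ρ →
    f x ≤ K / volume.real (ball x r) * ∫ y in ball x r, f y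

/-- A quantitative form of Domar's criterion: if the excess of `f` over the levels `T i` is
controlled in mean by the weights `1 / w i ^ (N - 1)`, and `∑ w i` is small enough, then `f` is
bounded by `T s₀` on the half ball. -/
theorem le_of_mean_value_of_summable {N : ℕ} {K C ρ A S : ℝ} (hK : 1 ≤ K)
    {x₀ : Eucl (N + 1)} (hρ : 0 < ρ) {f : Eucl (N + 1) → ℝ}
    (hf : IsBoundedMeanValue K f x₀ ρ)
    {T : ℕ → ℝ} (hTmono : Monotone T) (hTpos : ∀ i, 0 < T i) (hT : Tendsto T atTop atTop)
    {s₀ : ℕ} (h2K : ∀ i, 2 * K * T i ≤ T (i + s₀)) (hCT : ∀ i, T (i + 1) ≤ C * T i)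
    {g : Eucl (N + 1) → ENNReal} {w : ℕ → ℝ} (hw : ∀ i, 0 < w i)
    (hg : ∀ i, ∀ x ∈ ball x₀ ρ, T i < f x → ENNReal.ofReal (1 / w i ^ N) ≤ g x)
    (hA0 : 0 < A) (hA : ∫⁻ x in ball x₀ ρ, g x ≤ ENNReal.ofReal A)
    (hS : ∀ k, ∑ i ∈ Finset.range k, w i ≤ S)
    (hsmall : 2 * K * C * (s₀ + 1) * 4 ^ (N + 1) * A * S ^ N ≤
      ρ ^ (N + 1) * volume.real (ball (0 : Eucl (N + 1)) 1)) :
    ∀ x ∈ closedBall x₀ (ρ / 2), f x ≤ T s₀ := by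
  obtain ⟨hf0, hfm, ⟨B, hB⟩, hmv⟩ := hf
  have : IsFiniteMeasure (volume.restrict (ball x₀ ρ)) :=
    ⟨by simpa using measure_ball_lt_top⟩
  have hS0 : 0 < S := by
    have := hS 1
    simp only [Finset.sum_range_one] at this
    exact (hw 0).trans_le this
  set ν := volume.real (ball (0 : Eucl (N + 1)) 1) with hν
  set e : ℕ → ℝ := fun i =>
    (volume.restrict (ball x₀ ρ)).real {y | T i < f y ∧ f y ≤ T (i + s₀ + 1)} with he
  have he0 : ∀ i, 0 ≤ e i := fun i => measureReal_nonneg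
  have hsum : ∀ k, ∑ i ∈ Finset.range k, 1 / w i ^ N * e i ≤ (s₀ + 1) * A := fun k =>
    sum_measure_levels_le hfm hTmono s₀ k (fun i => by have := hw i; positivity)
      (ae_restrict_of_forall_mem measurableSet_ball fun x hx i => hg i x hx) hA0.le hA
  -- `α` and `β` are normalised so that each of the two summands of `R i` has total at most `ρ / 4`.
  -- The first summand pays for the measure of the band; the second keeps the radius at least `β * w
  -- i`.
  set α := ρ / (4 * (s₀ + 1) * A) with hα
  set β := ρ / (4 * S) with hβ
  have hα0 : 0 < α := by positivity
  have hβ0 : 0 < β := by positivity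
  set R : ℕ → ℝ := fun i => α * (1 / w i ^ N * e i) + β * w i with hR
  have hR0 : ∀ i, 0 < R i := fun i => by
    have := hw i
    have := he0 i
    positivity
  have hRsum : ∀ k, ∑ i ∈ Finset.range k, R i ≤ ρ / 2 := fun k => by
    rw [Finset.sum_add_distrib, ← Finset.mul_sum, ← Finset.mul_sum]
    calc _ ≤ α * ((s₀ + 1) * A) + β * S :=
          add_le_add (mul_le_mul_of_nonneg_left (hsum k) hα0.le)
            (mul_le_mul_of_nonneg_left (hS k) hβ0.le)
      _ = ρ / 2 := by rw [hα, hβ]; field_simp; norm_num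
  have hRpow : ∀ i, 2 * K * C * e i ≤ R i ^ (N + 1) * ν := fun i => by
    have hwi := hw i
    have hei := he0 i
    -- One factor of `R i ^ (N + 1)` is bounded below by the first summand and the other `N` by the
    -- second, so that the powers of `w i` cancel.
    have h1 : α * (1 / w i ^ N * e i) * (β * w i) ^ N ≤ R i ^ (N + 1) := by
      rw [pow_succ' (R i)]
      have h2 : α * (1 / w i ^ N * e i) ≤ R i := le_add_of_nonneg_right (by positivity)
      have h3 : β * w i ≤ R i := le_add_of_nonneg_left (by positivity)
      have := (hR0 i).le
      gcongr
    have h4 : α * (1 / w i ^ N * e i) * (β * w i) ^ N = α * β ^ N * e i := by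
      rw [mul_pow]; field_simp
    have hν0 : 0 ≤ ν := measureReal_nonneg
    have h5 : 2 * K * C ≤ α * β ^ N * ν := by
      have : α * β ^ N * ν = ρ ^ (N + 1) * ν / ((s₀ + 1) * 4 ^ (N + 1) * A * S ^ N) := by
        rw [hα, hβ, div_pow, mul_pow]; field_simp; ring
      rw [this, le_div_iff₀ (by positivity)]
      linarith
    calc 2 * K * C * e i ≤ α * β ^ N * ν * e i := by gcongr
      _ = α * (1 / w i ^ N * e i) * (β * w i) ^ N * ν := by rw [h4]; ring
      _ ≤ _ := by gcongr
  obtain ⟨k, hk⟩ := (hT.eventually_ge_atTop B).exists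
  -- Descent from level `k` to level `0`, shrinking the ball by `R l` each time. The bound `B` only
  -- starts the descent: neither it nor `k` survives, since the total loss of radius is at most `ρ /
  -- 2`.
  have key : ∀ d l, l + d = k → ∀ x ∈ closedBall x₀ (ρ - ∑ i ∈ Finset.Ico l k, R i),
      f x ≤ T (l + s₀) := by
    intro d
    induction d with
    | zero =>
      intro l hl x hx
      obtain rfl : l = k := hl
      simp only [Finset.Ico_self, Finset.sum_empty, sub_zero] at hx
      exact (hB x hx).trans (hk.trans (hTmono (Nat.le_add_right _ _)))
    | succ d ih =>
      intro l hl x hx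
      have hlk : l < k := by omega
      rw [Finset.sum_eq_sum_Ico_succ_bot hlk] at hx
      have hnn : 0 ≤ ∑ i ∈ Finset.Ico (l + 1) k, R i := Finset.sum_nonneg fun i _ => (hR0 i).le
      rw [mem_closedBall] at hx
      refine le_of_mean_value_of_measure_level_le (R := R l) (a := T l) (d := T (l + s₀ + 1))
        (C := C) (K := K)
        measure_ball_lt_top.ne hK (hR0 l) (ball_subset_ball' ?_) hf0 hfm
        (hmv x _ (hR0 l) (closedBall_subset_closedBall' ?_)) (hTpos l).le (h2K l)
        (hTpos _) (fun y hy => ?_) (hCT _) (hRpow l)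
      · linarith
      · linarith
      · have := ih (l + 1) (by omega) y ?_
        · rwa [add_right_comm] at this
        · rw [mem_ball] at hy
          rw [mem_closedBall]
          have := dist_triangle y x x₀
          linarith
  intro x hx
  have := key k 0 (by simp) x (closedBall_subset_closedBall ?_ hx)
  · simpa using this
  · have := hRsum k
    rw [← Finset.range_eq_Ico]
    linarith

/-! ### Series, integrals and tails -/

theorem summable_of_le_integrableOn {F : ℝ → ℝ} {b : ℝ} (hF : IntegrableOn F (Set.Ioi b))
    (hF0 : ∀ s ∈ Set.Ioi b, 0 ≤ F s) {a : ℕ → ℝ} (ha0 : ∀ k, 0 ≤ a k)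
    (ha : ∀ k : ℕ, ∀ s ∈ Set.Ioc (b + k) (b + (k + 1 : ℕ)), a k ≤ F s) : Summable a := by
  have hint : ∀ k : ℕ, IntervalIntegrable F volume (b + k) (b + (k + 1 : ℕ)) := fun k => by
    rw [intervalIntegrable_iff_integrableOn_Ioc_of_le (by push_cast; linarith)]
    exact hF.mono_set fun s hs => lt_of_le_of_lt (by simp) hs.1
  refine summable_of_sum_range_le (c := ∫ s in Set.Ioi b, F s) ha0 fun L => ?_
  calc ∑ k ∈ Finset.range L, a k
      ≤ ∑ k ∈ Finset.range L, ∫ s in (b + k)..(b + (k + 1 : ℕ)), F s := by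
        refine Finset.sum_le_sum fun k _ => ?_
        have h := intervalIntegral.integral_mono_on_of_le_Ioo (μ := volume) (f := fun _ => a k)
          (g := F) (a := b + k) (b := b + (k + 1 : ℕ)) (by push_cast; linarith) (by simp) (hint k)
          fun s hs => ha k s (Set.Ioo_subset_Ioc_self hs)
        simpa using h
    _ = ∫ s in (b + (0 : ℕ))..(b + L), F s :=
        intervalIntegral.sum_integral_adjacent_intervals (a := fun k : ℕ => b + k)
          fun k _ => hint k
    _ = ∫ s in Set.Ioc b (b + L), F s := by
        rw [intervalIntegral.integral_of_le (by simp)]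
        simp
    _ ≤ _ := setIntegral_mono_set hF (ae_restrict_of_forall_mem measurableSet_Ioi hF0)
        (Set.Ioc_subset_Ioi_self).eventuallyLE

/-- Telescoping: Bernoulli's inequality at `-1 / (L + 1)` gives `(L + 1)^(q - 1) ≤ q⁻¹ * ((L + 1)^q
- L^q)`. -/
theorem sum_rpow_sub_one_le {q : ℝ} (hq0 : 0 < q) (hq1 : q ≤ 1) (L : ℕ) :
    ∑ j ∈ Finset.range L, ((j : ℝ) + 1) ^ (q - 1) ≤ q⁻¹ * (L : ℝ) ^ q := by
  induction L with
  | zero => simp [Real.zero_rpow hq0.ne']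
  | succ L ih =>
    rw [Finset.sum_range_succ]
    have hL : (0 : ℝ) < L + 1 := by positivity
    have h := rpow_one_add_le_one_add_mul_self (s := -1 / ((L : ℝ) + 1))
      (by rw [le_div_iff₀ hL]; linarith [(Nat.cast_nonneg L : (0 : ℝ) ≤ L)]) hq0.le hq1
    have h1 : 1 + -1 / ((L : ℝ) + 1) = L / (L + 1) := by field_simp; ring
    rw [h1, Real.div_rpow (by positivity) hL.le, div_le_iff₀ (by positivity)] at h
    have h2 : ((L : ℝ) + 1) ^ (q - 1) = ((L : ℝ) + 1) ^ q / (L + 1) := by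
      rw [Real.rpow_sub hL, Real.rpow_one]
    have h3 : q⁻¹ * (L : ℝ) ^ q ≤ q⁻¹ * ((1 + q * (-1 / ((L : ℝ) + 1))) * ((L : ℝ) + 1) ^ q) := by
      gcongr
    have h4 : q⁻¹ * ((1 + q * (-1 / ((L : ℝ) + 1))) * ((L : ℝ) + 1) ^ q) =
        q⁻¹ * ((L : ℝ) + 1) ^ q - ((L : ℝ) + 1) ^ q / (L + 1) := by
      field_simp
      ring
    push_cast
    linarith

/-- A Hardy-type inequality for tails of series. -/
theorem summable_tail_rpow {q : ℝ} (hq0 : 0 < q) (hq1 : q ≤ 1) {ψ : ℕ → ℝ} (hψ : ∀ k, 0 ≤ ψ k)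
    (hsum : Summable fun k : ℕ => ((k : ℝ) + 1) ^ q * ψ k) :
    Summable fun l : ℕ => (∑' k, ψ (k + l)) ^ q⁻¹ := by
  have hψs : Summable ψ := hsum.of_nonneg_of_le hψ fun k =>
    le_mul_of_one_le_left (hψ k) (Real.one_le_rpow (by simp) hq0.le)
  set Ψ : ℕ → ℝ := fun l => ∑' k, ψ (k + l) with hΨ
  have hΨ0 : ∀ l, 0 ≤ Ψ l := fun l => tsum_nonneg fun k => hψ _
  have hΨs : ∀ l, Ψ l = ψ l + Ψ (l + 1) := fun l => by
    have := ((summable_nat_add_iff l).2 hψs).tsum_eq_zero_add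
    simp only [zero_add] at this
    rw [hΨ]
    dsimp only
    rw [this]
    congr 1
    exact tsum_congr fun k => by rw [add_right_comm, add_assoc]
  set B := ∑' k : ℕ, ((k : ℝ) + 1) ^ q * ψ k with hB
  have hB0 : 0 ≤ B := tsum_nonneg fun k => mul_nonneg (by positivity) (hψ k)
  have hΨB : ∀ l : ℕ, ((l : ℝ) + 1) ^ q * Ψ l ≤ B := fun l => by
    rw [hΨ]
    dsimp only
    rw [← tsum_mul_left]
    calc ∑' k, ((l : ℝ) + 1) ^ q * ψ (k + l)
        ≤ ∑' k : ℕ, (((k + l : ℕ) : ℝ) + 1) ^ q * ψ (k + l) := by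
          refine Summable.tsum_le_tsum (fun k => ?_)
            (((summable_nat_add_iff l).2 hψs).mul_left _) ((summable_nat_add_iff l).2 hsum)
          -- On the tail the weight `(k + l + 1)^q` is at least `(l + 1)^q`.
          have := hψ (k + l)
          gcongr
          exact Nat.le_add_left _ _
      _ ≤ B := by
          rw [hB, ← hsum.sum_add_tsum_nat_add l]
          exact le_add_of_nonneg_left
            (Finset.sum_nonneg fun k _ => mul_nonneg (by positivity) (hψ k))
  -- Summation by parts trades the tails `Ψ j` for the terms `ψ k`, with partial sums of `(j + 1)^(q
  -- - 1)` as coefficients; these are of order `(k + 1)^q`.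
  have habel : ∀ L : ℕ, ∑ j ∈ Finset.range L, ((j : ℝ) + 1) ^ (q - 1) * Ψ j =
      (∑ j ∈ Finset.range L, ((j : ℝ) + 1) ^ (q - 1)) * Ψ L +
        ∑ k ∈ Finset.range L, (∑ j ∈ Finset.range (k + 1), ((j : ℝ) + 1) ^ (q - 1)) * ψ k := by
    intro L
    induction L with
    | zero => simp
    | succ L ih =>
      rw [Finset.sum_range_succ, ih, Finset.sum_range_succ (n := L)
        (f := fun k => (∑ j ∈ Finset.range (k + 1), ((j : ℝ) + 1) ^ (q - 1)) * ψ k),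
        Finset.sum_range_succ (n := L) (f := fun j : ℕ => ((j : ℝ) + 1) ^ (q - 1)), hΨs L]
      ring
  have hweighted : Summable fun j : ℕ => ((j : ℝ) + 1) ^ (q - 1) * Ψ j := by
    refine summable_of_sum_range_le (c := q⁻¹ * B + q⁻¹ * B)
      (fun j => mul_nonneg (by positivity) (hΨ0 j)) fun L => ?_
    rw [habel]
    refine add_le_add ?_ ?_
    · calc _ ≤ q⁻¹ * (L : ℝ) ^ q * Ψ L :=
            mul_le_mul_of_nonneg_right (sum_rpow_sub_one_le hq0 hq1 L) (hΨ0 L)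
        _ ≤ q⁻¹ * ((L : ℝ) + 1) ^ q * Ψ L := by
            have := hΨ0 L
            gcongr
            linarith
        _ ≤ q⁻¹ * B := by
            rw [mul_assoc]
            gcongr
            exact hΨB L
    · calc _ ≤ ∑ k ∈ Finset.range L, q⁻¹ * (((k : ℝ) + 1) ^ q * ψ k) := by
            refine Finset.sum_le_sum fun k _ => ?_
            rw [← mul_assoc]
            have := sum_rpow_sub_one_le hq0 hq1 (k + 1)
            push_cast at this
            exact mul_le_mul_of_nonneg_right this (hψ k)
        _ ≤ q⁻¹ * B := by
            rw [← Finset.mul_sum]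
            gcongr
            exact hsum.sum_le_tsum _ fun k _ => mul_nonneg (by positivity) (hψ k)
  refine (hweighted.mul_left (B ^ (q⁻¹ - 1))).of_nonneg_of_le
    (fun l => Real.rpow_nonneg (hΨ0 l) _) fun l => ?_
  rcases (hΨ0 l).eq_or_lt with h | h
  · have : (∑' k, ψ (k + l)) = 0 := h.symm
    rw [this, Real.zero_rpow (by positivity)]
    exact mul_nonneg (by positivity) (mul_nonneg (by positivity) (hΨ0 l))
  · have hl : (0 : ℝ) < l + 1 := by positivity
    have hq2 : 0 ≤ q⁻¹ - 1 := sub_nonneg.2 ((one_le_inv₀ hq0).2 hq1)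
    -- Only the excess power `q⁻¹ - 1` is estimated by `Ψ l ≤ B * (l + 1)^(-q)`. As `-q * (q⁻¹ - 1)
    -- = q - 1`, the weight of `hweighted` appears.
    calc Ψ l ^ q⁻¹ = Ψ l ^ (q⁻¹ - 1) * Ψ l := by
          rw [Real.rpow_sub h, Real.rpow_one]; field_simp
      _ ≤ (B * ((l : ℝ) + 1) ^ (-q)) ^ (q⁻¹ - 1) * Ψ l := by
          gcongr
          rw [Real.rpow_neg hl.le, ← div_eq_mul_inv, le_div_iff₀ (by positivity), mul_comm]
          exact hΨB l
      _ = _ := by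
          rw [Real.mul_rpow hB0 (by positivity), ← Real.rpow_mul hl.le, mul_assoc]
          congr 3
          field_simp
          ring

/-! ### Domar's method in two groups of variables -/

/-- Domar's criterion in each variable: if the excess of `h` over the levels `T i` is controlled in
mean by weights `1 / ψ i ^ m` such that the tails of `∑ ψ i` are summable with exponent `m / n`,
then `h` is bounded on a product of half balls. -/
theorem bounded_of_separately_mean_value {m n : ℕ} (hn : 1 ≤ n) {K C ρ : ℝ}
    (hK : 1 ≤ K) (hC : 0 < C) {x₀ : Eucl (m + 1)} {y₀ : Eucl (n + 1)} (hρ : 0 < ρ)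
    {h : Eucl (m + 1) → Eucl (n + 1) → ℝ}
    (hx : ∀ y ∈ closedBall y₀ ρ, IsBoundedMeanValue K (fun x => h x y) x₀ ρ)
    (hy : ∀ x ∈ closedBall x₀ ρ, IsBoundedMeanValue K (fun y => h x y) y₀ ρ)
    {T : ℕ → ℝ} (hTmono : Monotone T) (hTpos : ∀ i, 0 < T i) (hT : Tendsto T atTop atTop)
    {s₀ : ℕ} (h2K : ∀ i, 2 * K * T i ≤ T (i + s₀)) (hCT : ∀ i, T (i + 1) ≤ C * T i)
    {G : Eucl (m + 1) → Eucl (n + 1) → ENNReal} {ψ : ℕ → ℝ} (hψ : ∀ i, 0 < ψ i)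
    (hG : ∀ i, ∀ x ∈ ball x₀ ρ, ∀ y ∈ ball y₀ ρ, T i < h x y →
      ENNReal.ofReal (1 / ψ i ^ m) ≤ G x y)
    (hGint : ∫⁻ y in ball y₀ ρ, ∫⁻ x in ball x₀ ρ, G x y ≠ ⊤)
    (hsum : Summable ψ) (hsum' : Summable fun l => (∑' k, ψ (k + l)) ^ ((m : ℝ) / n)) :
    ∃ B, ∀ x ∈ closedBall x₀ (ρ / 2), ∀ y ∈ closedBall y₀ (ρ / 2), h x y ≤ B := by
  set Ψ : ℕ → ℝ := fun l => ∑' k, ψ (k + l) with hΨ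
  have hshift : ∀ l, Summable fun k => ψ (k + l) := fun l => (summable_nat_add_iff l).2 hsum
  have hΨ0 : ∀ l, 0 < Ψ l := fun l =>
    (hshift l).tsum_pos (fun k => (hψ _).le) 0 (hψ _)
  have hνm := volume_real_unitBall_pos (m + 1)
  have hνn := volume_real_unitBall_pos (n + 1)
  -- With this `c`, the smallness condition of the one-variable criterion is an equality for `A = 1
  -- / (c * Ψ l ^ m)` and `S = Ψ l`.
  set c : ℝ := 2 * K * C * (s₀ + 1) * 4 ^ (m + 1) /
    (ρ ^ (m + 1) * volume.real (ball (0 : Eucl (m + 1)) 1)) with hc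
  have hc0 : 0 < c := by positivity
  set A : Eucl (n + 1) → ENNReal := fun y => ∫⁻ x in ball x₀ ρ, G x y with hA
  -- The criterion in `x` read contrapositively, with the levels shifted by `l`.
  have hfirst : ∀ l, ∀ x ∈ closedBall x₀ (ρ / 2), ∀ y ∈ ball y₀ ρ, T (l + s₀) < h x y →
      ENNReal.ofReal (1 / (c * Ψ l ^ m)) ≤ A y := by
    intro l x hxx y hyy hlt
    by_contra! hcon
    have hpos := hΨ0 l
    refine absurd hlt (not_lt.2 ?_)
    have := le_of_mean_value_of_summable (A := 1 / (c * Ψ l ^ m)) (S := Ψ l) (s₀ := s₀)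
      (T := fun i => T (i + l)) (w := fun i => ψ (i + l)) (C := C) (g := fun x => G x y)
      hK hρ (hx y (ball_subset_closedBall hyy)) (fun i j hij => hTmono (by omega))
      (fun i => hTpos _) (hT.comp (tendsto_add_atTop_nat l))
      (fun i => by rw [add_right_comm]; exact h2K _) (fun i => by rw [add_right_comm]; exact hCT _)
      (fun i => hψ _) (fun i x hxx' => hG _ x hxx' y hyy) (by positivity) hcon.le
      (fun k => (hshift l).sum_le_tsum _ fun i _ => (hψ _).le)
      (by rw [hc]; field_simp; rfl) x hxx
    rwa [add_comm]
  set p : ℝ := (m : ℝ) / n with hp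
  have hn0 : (n : ℝ) ≠ 0 := by positivity
  set κ : ℝ := c ^ (n : ℝ)⁻¹ with hκ
  have hκ0 : 0 < κ := Real.rpow_pos_of_pos hc0 _
  -- Rewrites the lower bound for `A y` in the form `1 / w ^ n` demanded by the criterion in `y`.
  have hpow : ∀ l, (κ * Ψ l ^ p) ^ n = c * Ψ l ^ m := fun l => by
    rw [mul_pow, hκ, Real.rpow_inv_natCast_pow hc0.le (by omega), ← Real.rpow_mul_natCast (hΨ0 l).le,
      hp, div_mul_cancel₀ _ hn0, Real.rpow_natCast]
  have htail : Tendsto (fun l => κ * ∑' i, Ψ (i + l) ^ p) atTop (𝓝 (κ * 0)) :=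
    (tendsto_sum_nat_add fun l => Ψ l ^ p).const_mul κ
  -- The added `1` makes `a` positive even if the integral vanishes.
  set a : ℝ := (∫⁻ y in ball y₀ ρ, A y).toReal + 1 with ha
  have ha0 : 0 < a := by positivity
  have hlim : Tendsto (fun l => 2 * K * C * (s₀ + 1) * 4 ^ (n + 1) * a *
      (κ * ∑' i, Ψ (i + l) ^ p) ^ n) atTop (𝓝 0) := by
    have := (htail.pow n).const_mul (2 * K * C * (s₀ + 1) * 4 ^ (n + 1) * a)
    rwa [mul_zero, zero_pow (by omega), mul_zero] at this
  -- Discarding the first `l` levels makes the tail sum small enough. The choice depends on neither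
  -- `x` nor `y`, so the final bound is uniform.
  obtain ⟨l, hl⟩ := (hlim.eventually_le_const
    (show 0 < ρ ^ (n + 1) * volume.real (ball (0 : Eucl (n + 1)) 1) by positivity)).exists
  refine ⟨T (s₀ + (l + s₀)), fun x hxx y hyy => ?_⟩
  refine le_of_mean_value_of_summable (A := a) (S := κ * ∑' i, Ψ (i + l) ^ p) (s₀ := s₀)
    (T := fun i => T (i + (l + s₀))) (w := fun i => κ * Ψ (i + l) ^ p) (C := C) (g := A)
    hK hρ (hy x (closedBall_subset_closedBall (by linarith) hxx))
    (fun i j hij => hTmono (by omega))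
    (fun i => hTpos _) (hT.comp (tendsto_add_atTop_nat _))
    (fun i => by rw [add_right_comm]; exact h2K _) (fun i => by rw [add_right_comm]; exact hCT _)
    (fun i => mul_pos hκ0 (Real.rpow_pos_of_pos (hΨ0 _) _)) (fun i y hyy' hlt => ?_) ha0 ?_ ?_ hl
    y hyy
  · rw [hpow]
    refine hfirst (i + l) x hxx y hyy' ?_
    rwa [add_assoc]
  · rw [ha, ENNReal.ofReal_add ENNReal.toReal_nonneg zero_le_one, ENNReal.ofReal_toReal hGint]
    exact le_self_add
  · intro k
    rw [← Finset.mul_sum]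
    gcongr
    exact ((summable_nat_add_iff l).2 hsum').sum_le_tsum _
      fun i _ => (Real.rpow_pos_of_pos (hΨ0 _) _).le

/-! ### Truncations, slices and Fubini -/

theorem trunc_zero {N : ℕ} (u : Eucl N → EReal) : trunc u 0 = uplus u := by
  ext x
  simp [trunc, uplus]

theorem uplus_nonneg {N : ℕ} (u : Eucl N → EReal) (x : Eucl N) : 0 ≤ uplus u x :=
  EReal.toReal_nonneg (le_max_right _ _)

theorem trunc_nonneg {N : ℕ} (u : Eucl N → EReal) {M : ℝ} (hM : 0 ≤ M) (x : Eucl N) :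
    0 ≤ trunc u M x := by
  unfold trunc
  rcases eq_or_ne (max (u x) ((-M : ℝ) : EReal)) ⊤ with h | h
  · rw [h]
    simpa using hM
  · have := EReal.toReal_le_toReal (le_max_right (u x) ((-M : ℝ) : EReal)) (EReal.coe_ne_bot _) h
    rw [EReal.toReal_coe] at this
    linarith

theorem trunc_le_uplus_add {N : ℕ} (u : Eucl N → EReal) {M : ℝ} (hM : 0 ≤ M) (x : Eucl N) :
    trunc u M x ≤ uplus u x + M := by
  unfold trunc uplus
  gcongr
  rcases eq_or_ne (u x) ⊤ with h | h
  · simp [h]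
  · refine EReal.toReal_le_toReal (max_le_max le_rfl ?_) ?_ ?_
    · exact_mod_cast neg_nonpos.2 hM
    · exact ne_bot_of_le_ne_bot (EReal.coe_ne_bot _) (le_max_right _ _)
    · rcases max_choice (u x) 0 with h' | h' <;> rw [h']
      exacts [h, EReal.zero_ne_top]

theorem aemeasurable_trunc {N : ℕ} {u : Eucl N → EReal} {μ : Measure (Eucl N)}
    (hu : AEMeasurable u μ) (M : ℝ) : AEMeasurable (trunc u M) μ :=
  (hu.max aemeasurable_const).ereal_toReal.add_const M

/-- The case `M = 0` of the mean value inequality. Boundedness comes from balls of the fixed radius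
`ρ`, all contained in the doubled ball, where `v⁺` is integrable. -/
theorem IsKQuasinearlySubharmonic.isBoundedMeanValue {N : ℕ} {K : ℝ} {D : Set (Eucl N)}
    {v : Eucl N → EReal} (hv : IsKQuasinearlySubharmonic K D v) {x₀ : Eucl N} {ρ : ℝ} (hρ : 0 < ρ)
    (hD : closedBall x₀ (2 * ρ) ⊆ D) : IsBoundedMeanValue K (uplus v) x₀ ρ := by
  have hsub : closedBall x₀ ρ ⊆ closedBall x₀ (2 * ρ) :=
    closedBall_subset_closedBall (by linarith)
  have hmv : ∀ x r, 0 < r → closedBall x r ⊆ D →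
      uplus v x ≤ K / volume.real (ball x r) * ∫ y in ball x r, uplus v y := fun x r hr hxr => by
    have := hv.mean_value x r hr hxr 0 le_rfl
    rwa [trunc_zero] at this
  refine ⟨uplus_nonneg v, ?_, ?_, fun x r hr hxr => hmv x r hr (hxr.trans (hsub.trans hD))⟩
  · rw [← trunc_zero]
    exact aemeasurable_trunc (hv.measurable.mono_measure (Measure.restrict_mono_set _
      (ball_subset_closedBall.trans (hsub.trans hD)))) 0
  · refine ⟨K / (ρ ^ N * volume.real (ball (0 : Eucl N) 1)) *
      ∫ y in closedBall x₀ (2 * ρ), uplus v y, fun x hx => ?_⟩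
    have hx2 : closedBall x ρ ⊆ closedBall x₀ (2 * ρ) :=
      closedBall_subset_closedBall' (by rw [mem_closedBall] at hx; linarith)
    refine (hmv x ρ hρ (hx2.trans hD)).trans ?_
    rw [volume_real_ball x hρ]
    have := volume_real_unitBall_pos N
    have := hv.one_le
    gcongr
    · exact Eventually.of_forall fun y => uplus_nonneg v y
    · exact hv.locallyIntegrable.integrableOn_compact_subset hD (isCompact_closedBall _ _)
    · exact ball_subset_closedBall.trans hx2

theorem aemeasurable_comp_join {m n : ℕ} {S : Set (Eucl m)} {R : Set (Eucl n)}
    {F : Eucl (m + n) → ENNReal}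
    (hF : AEMeasurable F (volume.restrict ((fun p : Eucl m × Eucl n => join p.1 p.2) '' S ×ˢ R))) :
    AEMeasurable (fun p : Eucl m × Eucl n => F (join p.1 p.2))
      ((volume.restrict S).prod (volume.restrict R)) := by
  rw [Measure.prod_restrict]
  exact AEMeasurable.comp_quasiMeasurePreserving hF ((measurePreserving_join m n).restrict_image_emb
    (measurableEmbedding_join m n) _).quasiMeasurePreserving

theorem lintegral_join {m n : ℕ} {S : Set (Eucl m)} {R : Set (Eucl n)}
    {F : Eucl (m + n) → ENNReal}
    (hF : AEMeasurable F (volume.restrict ((fun p : Eucl m × Eucl n => join p.1 p.2) '' S ×ˢ R))) :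
    ∫⁻ x in S, ∫⁻ y in R, F (join x y) =
      ∫⁻ z in (fun p : Eucl m × Eucl n => join p.1 p.2) '' S ×ˢ R, F z := by
  rw [← (measurePreserving_join m n).setLIntegral_comp_emb (measurableEmbedding_join m n),
    Measure.volume_eq_prod, ← Measure.prod_restrict, lintegral_prod _ (aemeasurable_comp_join hF)]

theorem lintegral_join_symm {m n : ℕ} {S : Set (Eucl m)} {R : Set (Eucl n)}
    {F : Eucl (m + n) → ENNReal}
    (hF : AEMeasurable F (volume.restrict ((fun p : Eucl m × Eucl n => join p.1 p.2) '' S ×ˢ R))) :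
    ∫⁻ y in R, ∫⁻ x in S, F (join x y) =
      ∫⁻ z in (fun p : Eucl m × Eucl n => join p.1 p.2) '' S ×ˢ R, F z := by
  rw [← (measurePreserving_join m n).setLIntegral_comp_emb (measurableEmbedding_join m n),
    Measure.volume_eq_prod, ← Measure.prod_restrict,
    lintegral_prod_symm _ (aemeasurable_comp_join hF)]

/-! ### Levels and weights from the growth conditions -/

theorem orderIso_pos (φ : ℝ≥0 ≃o ℝ≥0) {t : ℝ≥0} (ht : 0 < t) : 0 < φ t := by
  have h0 : φ 0 = 0 := φ.map_bot
  rw [← h0]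
  exact φ.strictMono ht

theorem summable_rpow_mul_weight (φ : ℝ≥0 ≃o ℝ≥0) {s₀ s₁ J : ℕ} (hJ : s₁ + 2 ≤ J) {q r : ℝ}
    (hq : 0 ≤ q) (hr : 0 ≤ r)
    (hint : IntegrableOn (fun s : ℝ => s ^ q / (φ (s - s₀).toNNReal : ℝ) ^ r)
      (Set.Ioi (s₁ : ℝ)) volume) :
    Summable fun k : ℕ => ((k : ℝ) + 1) ^ q * (φ ((J + k : ℕ) : ℝ≥0) : ℝ) ^ (-r) := by
  -- On `(b + k, b + k + 1]` one has `s - s₀ ≤ J + k` and `s ≥ k + 1`, so the integrand dominates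
  -- the `k`-th term.
  set b : ℝ := (J : ℝ) + s₀ - 1 with hb
  have hJ' : (s₁ : ℝ) + 2 ≤ J := by exact_mod_cast hJ
  have hs₀ : (0 : ℝ) ≤ s₀ := by positivity
  have hs₁ : (0 : ℝ) ≤ s₁ := by positivity
  refine summable_of_le_integrableOn (b := b)
    (hint.mono_set (Set.Ioi_subset_Ioi (by linarith))) (fun s hs => ?_) (fun k => by positivity)
    fun k s hs => ?_
  · have : 0 ≤ s := by
      have : b < s := hs
      linarith
    positivity
  · have hk : (0 : ℝ) ≤ k := by positivity
    have h1 := hs.1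
    have h2 := hs.2
    push_cast at h2
    have hs0 : 0 ≤ s := by linarith
    have hpos : 0 < φ (s - s₀).toNNReal := orderIso_pos φ (by
      rw [Real.toNNReal_pos]
      linarith)
    have hle : φ (s - s₀).toNNReal ≤ φ ((J + k : ℕ) : ℝ≥0) := φ.monotone (by
      rw [← Real.toNNReal_natCast]
      refine Real.toNNReal_le_toNNReal ?_
      push_cast
      linarith)
    have hpos' : (0 : ℝ) < φ (s - s₀).toNNReal := by exact_mod_cast hpos
    have hle' : (φ (s - s₀).toNNReal : ℝ) ≤ φ ((J + k : ℕ) : ℝ≥0) := by exact_mod_cast hle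
    rw [Real.rpow_neg (by positivity), ← div_eq_mul_inv]
    gcongr
    linarith

/-- The levels `ϕ⁻¹(e^(J + i))`. -/
noncomputable def level (ϕ : ℝ≥0 ≃o ℝ≥0) (J i : ℕ) : ℝ :=
  (ϕ.symm (Real.exp ((J + i : ℕ) : ℝ)).toNNReal : ℝ)

theorem level_monotone (ϕ : ℝ≥0 ≃o ℝ≥0) (J : ℕ) : Monotone (level ϕ J) := fun i j hij =>
  NNReal.coe_le_coe.2 (ϕ.symm.monotone (Real.toNNReal_mono (Real.exp_le_exp.2 (by gcongr))))

theorem level_pos (ϕ : ℝ≥0 ≃o ℝ≥0) (J i : ℕ) : 0 < level ϕ J i :=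
  NNReal.coe_pos.2 (orderIso_pos ϕ.symm (Real.toNNReal_pos.2 (Real.exp_pos _)))

theorem level_tendsto (ϕ : ℝ≥0 ≃o ℝ≥0) (J : ℕ) : Tendsto (level ϕ J) atTop atTop :=
  NNReal.tendsto_coe_atTop.2 (ϕ.symm.tendsto_atTop.comp (tendsto_real_toNNReal_atTop.comp
    (Real.tendsto_exp_atTop.comp (tendsto_natCast_atTop_atTop.comp
      (tendsto_atTop_mono (fun i => Nat.le_add_left i J) tendsto_id)))))

theorem level_add_le {ϕ : ℝ≥0 ≃o ℝ≥0} {K : ℝ} {s₀ s₁ J : ℕ} (hJ : s₁ ≤ J)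
    (hc1 : ∀ s : ℝ, (s₁ : ℝ) ≤ s →
      2 * K * (ϕ.symm (Real.exp (s - s₀)).toNNReal : ℝ) ≤ (ϕ.symm (Real.exp s).toNNReal : ℝ))
    (i : ℕ) : 2 * K * level ϕ J i ≤ level ϕ J (i + s₀) := by
  have := hc1 ((J + (i + s₀) : ℕ) : ℝ) (by exact_mod_cast (by omega))
  have h2 : ((J + (i + s₀) : ℕ) : ℝ) - s₀ = ((J + i : ℕ) : ℝ) := by push_cast; ring
  rwa [h2] at this

theorem level_succ_le {ϕ : ℝ≥0 ≃o ℝ≥0} (hc2 : DeltaTwo ϕ.symm) :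
    ∃ C : ℝ, 0 < C ∧ ∃ J₀ : ℕ, ∀ J, J₀ ≤ J → ∀ i, level ϕ J (i + 1) ≤ C * level ϕ J i := by
  obtain ⟨C, t₀, h⟩ := hc2
  obtain ⟨J₀, hJ₀⟩ := ((tendsto_real_toNNReal_atTop.comp
    (Real.tendsto_exp_atTop.comp tendsto_natCast_atTop_atTop)).eventually_ge_atTop t₀).exists
  -- Since `e ≤ 4`, one step up costs two doublings, hence `C * C`; the `1` ensures positivity.
  refine ⟨C * C + 1, by positivity, J₀, fun J hJ i => ?_⟩
  set t := (Real.exp ((J + i : ℕ) : ℝ)).toNNReal with ht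
  have ht0 : t₀ ≤ t := hJ₀.trans (Real.toNNReal_mono (Real.exp_le_exp.2 (by
    exact_mod_cast hJ.trans (Nat.le_add_right _ _))))
  have hexp : (Real.exp ((J + (i + 1) : ℕ) : ℝ)).toNNReal ≤ 2 * (2 * t) := by
    rw [← NNReal.coe_le_coe, Real.coe_toNNReal _ (Real.exp_pos _).le]
    push_cast
    rw [ht, Real.coe_toNNReal _ (Real.exp_pos _).le, ← add_assoc, Real.exp_add]
    have := Real.exp_one_lt_d9
    have := Real.exp_pos ((J : ℝ) + i)
    push_cast
    nlinarith
  have h1 : ϕ.symm (2 * t) ≤ C * ϕ.symm t := h t ht0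
  have h2 : ϕ.symm (2 * (2 * t)) ≤ C * ϕ.symm (2 * t) :=
    h (2 * t) (ht0.trans (le_mul_of_one_le_left zero_le one_le_two))
  have h3 : ϕ.symm (Real.exp ((J + (i + 1) : ℕ) : ℝ)).toNNReal ≤ (C * C + 1) * ϕ.symm t :=
    calc _ ≤ C * ϕ.symm (2 * t) := (ϕ.symm.monotone hexp).trans h2
      _ ≤ C * (C * ϕ.symm t) := by gcongr
      _ ≤ (C * C + 1) * ϕ.symm t := by
        rw [← mul_assoc]
        gcongr
        exact le_self_add
  exact_mod_cast h3

/-- If `t > ϕ⁻¹(e^(J+i))`, then `log⁺ ϕ(t) ≥ J + i`: the integrand of (c4) is at least `φ(J + i)`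
above the `i`-th level. -/
theorem weight_le_of_level_lt (φ ϕ : ℝ≥0 ≃o ℝ≥0) {J i : ℕ} {t : ℝ} (h : level ϕ J i < t) :
    (φ ((J + i : ℕ) : ℝ≥0) : ℝ) ≤ φ (Real.posLog (ϕ t.toNNReal : ℝ)).toNNReal := by
  refine NNReal.coe_le_coe.2 (φ.monotone ?_)
  rw [← Real.toNNReal_natCast]
  refine Real.toNNReal_mono ((Real.le_log_iff_exp_le ?_).2 ?_ |>.trans (le_max_right _ _))
  · exact NNReal.coe_pos.2 (orderIso_pos ϕ (Real.toNNReal_pos.2 ((level_pos ϕ J i).trans h)))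
  · have h1 : ϕ.symm (Real.exp ((J + i : ℕ) : ℝ)).toNNReal ≤ t.toNNReal :=
      NNReal.le_toNNReal_of_coe_le h.le
    have h2 := ϕ.monotone h1
    rw [OrderIso.apply_symm_apply] at h2
    exact (Real.le_coe_toNNReal _).trans (NNReal.coe_le_coe.2 h2)

/-! ### Local boundedness from above -/

theorem exists_closedBall_subset_join {m n : ℕ} {Ω : Set (Eucl (m + n))} (hΩ : IsOpen Ω)
    {x₀ : Eucl m} {y₀ : Eucl n} (h : join x₀ y₀ ∈ Ω) :
    ∃ ρ > 0, ∀ x ∈ closedBall x₀ (2 * ρ), ∀ y ∈ closedBall y₀ (2 * ρ), join x y ∈ Ω := by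
  obtain ⟨ε, hε, hsub⟩ := Metric.isOpen_iff.1 hΩ _ h
  refine ⟨ε / 8, by positivity, fun x hx y hy => hsub ?_⟩
  rw [mem_closedBall] at hx hy
  rw [mem_ball]
  linarith [dist_join_le x x₀ y y₀]

theorem uplus_bounded_nhds {m n : ℕ} (hn : 1 ≤ n) (hmn : n ≤ m) {K : ℝ} (hK : 1 ≤ K)
    {Ω : Set (Eucl (m + 1 + (n + 1)))} (hΩ : IsOpen Ω) {u : Eucl (m + 1 + (n + 1)) → EReal}
    (ha : ∀ y : Eucl (n + 1), IsKQuasinearlySubharmonic K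
      {x : Eucl (m + 1) | join x y ∈ Ω} (fun x => u (join x y)))
    (hb : ∀ x : Eucl (m + 1), IsKQuasinearlySubharmonic K
      {y : Eucl (n + 1) | join x y ∈ Ω} (fun y => u (join x y)))
    (φ ϕ : ℝ≥0 ≃o ℝ≥0) (s₀ s₁ : ℕ)
    (hc1 : ∀ s : ℝ, (s₁ : ℝ) ≤ s →
      2 * K * (ϕ.symm (Real.exp (s - s₀)).toNNReal : ℝ) ≤ (ϕ.symm (Real.exp s).toNNReal : ℝ))
    (hc2 : DeltaTwo ϕ.symm)
    (hc3 : IntegrableOn (fun s : ℝ => s ^ ((n : ℝ) / m) /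
        (φ (s - s₀).toNNReal : ℝ) ^ (1 / (m : ℝ))) (Set.Ioi (s₁ : ℝ)) volume)
    (hc4 : LocallyIntegrableOn
      (fun z => (φ (Real.posLog (ϕ (uplus u z).toNNReal : ℝ)).toNNReal : ℝ)) Ω volume)
    {z : Eucl (m + 1 + (n + 1))} (hz : z ∈ Ω) :
    ∃ δ > 0, ∃ B, ∀ z' ∈ ball z δ, uplus u z' ≤ B := by
  obtain ⟨x₀, y₀, rfl⟩ := exists_join_eq z
  obtain ⟨ρ, hρ, hsub⟩ := exists_closedBall_subset_join hΩ hz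
  obtain ⟨C, hC, J₀, hCT⟩ := level_succ_le hc2
  set J := max J₀ (s₁ + 2) with hJ
  have hm : 1 ≤ m := hn.trans hmn
  have hm0 : (0 : ℝ) < m := by exact_mod_cast hm
  have hn0 : (0 : ℝ) < n := by exact_mod_cast hn
  have hmn' : (n : ℝ) ≤ m := by exact_mod_cast hmn
  have hq1 : (n : ℝ) / m ≤ 1 := (div_le_one hm0).2 hmn'
  -- Chosen so that `1 / ψ k ^ m = φ (J + k)`, the lower bound for the integrand of (c4) above level
  -- `k`.
  set ψ : ℕ → ℝ := fun k => (φ ((J + k : ℕ) : ℝ≥0) : ℝ) ^ (-(1 / (m : ℝ))) with hψ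
  have hφ0 : ∀ k, (0 : ℝ) < φ ((J + k : ℕ) : ℝ≥0) := fun k =>
    NNReal.coe_pos.2 (orderIso_pos φ (by exact_mod_cast (by omega)))
  have hψ0 : ∀ k, 0 < ψ k := fun k => Real.rpow_pos_of_pos (hφ0 k) _
  have hψpow : ∀ k, 1 / ψ k ^ m = φ ((J + k : ℕ) : ℝ≥0) := fun k => by
    rw [hψ]
    dsimp only
    rw [Real.rpow_neg (hφ0 k).le, inv_pow, one_div (m : ℝ),
      Real.rpow_inv_natCast_pow (hφ0 k).le (by omega), one_div, inv_inv]
  have hsum : Summable fun k : ℕ => ((k : ℝ) + 1) ^ ((n : ℝ) / m) * ψ k :=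
    summable_rpow_mul_weight φ (le_max_right _ _) (by positivity) (by positivity) hc3
  have hsub' : ∀ x ∈ closedBall x₀ ρ, ∀ y ∈ closedBall y₀ ρ, join x y ∈ Ω := fun x hx y hy =>
    hsub x (closedBall_subset_closedBall (by linarith) hx) y
      (closedBall_subset_closedBall (by linarith) hy)
  set Q := (fun p : Eucl (m + 1) × Eucl (n + 1) => join p.1 p.2) ''
    closedBall x₀ ρ ×ˢ closedBall y₀ ρ with hQ
  have hQint := hc4.integrableOn_compact_subset (t := Q)
    (by rintro _ ⟨p, hp, rfl⟩; exact hsub' _ hp.1 _ hp.2)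
    (((isCompact_closedBall _ _).prod (isCompact_closedBall _ _)).image (continuous_join _ _))
  set G : Eucl (m + 1 + (n + 1)) → ENNReal := fun z =>
    ENNReal.ofReal (φ (Real.posLog (ϕ (uplus u z).toNNReal : ℝ)).toNNReal : ℝ) with hG
  have hGint : ∫⁻ y in ball y₀ ρ, ∫⁻ x in ball x₀ ρ, G (join x y) ≠ ⊤ := by
    have hbQ : (fun p : Eucl (m + 1) × Eucl (n + 1) => join p.1 p.2) ''
        ball x₀ ρ ×ˢ ball y₀ ρ ⊆ Q :=
      Set.image_mono (Set.prod_mono ball_subset_closedBall ball_subset_closedBall)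
    have hint := hQint.mono_set hbQ
    rw [lintegral_join_symm hint.aemeasurable.ennreal_ofReal]
    exact hint.lintegral_lt_top.ne
  obtain ⟨B, hB⟩ := bounded_of_separately_mean_value hn hK hC hρ (x₀ := x₀) (y₀ := y₀)
    (h := fun x y => uplus u (join x y)) (T := level ϕ J) (G := fun x y => G (join x y)) (ψ := ψ)
    (s₀ := s₀)
    (fun y hy => (ha y).isBoundedMeanValue hρ fun x hx =>
      hsub x hx y (closedBall_subset_closedBall (by linarith) hy))
    (fun x hx => (hb x).isBoundedMeanValue hρ fun y hy =>
      hsub x (closedBall_subset_closedBall (by linarith) hx) y hy)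
    (level_monotone ϕ J) (level_pos ϕ J) (level_tendsto ϕ J)
    (level_add_le ((Nat.le_add_right _ 2).trans (le_max_right _ _)) hc1)
    (hCT J (le_max_left _ _)) hψ0
    (fun i x _ y _ hlt => by
      rw [hψpow]
      exact ENNReal.ofReal_le_ofReal (weight_le_of_level_lt φ ϕ hlt))
    hGint
    (hsum.of_nonneg_of_le (fun k => (hψ0 k).le) fun k =>
      le_mul_of_one_le_left (hψ0 k).le (Real.one_le_rpow (by simp) (by positivity)))
    (by
      have := summable_tail_rpow (by positivity) hq1 (fun k => (hψ0 k).le) hsum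
      rwa [inv_div] at this)
  refine ⟨ρ / 2, by positivity, B, fun z' hz' => ?_⟩
  obtain ⟨x, y, rfl⟩ := exists_join_eq (m := m + 1) (n := n + 1) z'
  rw [mem_ball] at hz'
  have hd := dist_join_sq x x₀ y y₀
  refine hB x ?_ y ?_ <;> rw [mem_closedBall] <;>
    refine (abs_le_of_sq_le_sq' ?_ dist_nonneg).2.trans hz'.le <;> rw [hd] <;> simp

theorem exists_uplus_le_of_isCompact {N : ℕ} {u : Eucl N → EReal} {Q : Set (Eucl N)}
    (hQ : IsCompact Q) (h : ∀ z ∈ Q, ∃ δ > 0, ∃ B, ∀ z' ∈ ball z δ, uplus u z' ≤ B) :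
    ∃ B, ∀ z ∈ Q, uplus u z ≤ B := by
  refine hQ.induction_on (p := fun S => ∃ B, ∀ z ∈ S, uplus u z ≤ B) ⟨0, by simp⟩ ?_ ?_ ?_
  · rintro s t hst ⟨B, hB⟩
    exact ⟨B, fun z hz => hB z (hst hz)⟩
  · rintro s t ⟨B, hB⟩ ⟨B', hB'⟩
    refine ⟨max B B', fun z hz => ?_⟩
    rcases hz with hz | hz
    exacts [(hB z hz).trans (le_max_left _ _), (hB' z hz).trans (le_max_right _ _)]
  · intro z hz
    obtain ⟨δ, hδ, B, hB⟩ := h z hz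
    exact ⟨ball z δ, mem_nhdsWithin_of_mem_nhds (ball_mem_nhds z hδ), B, hB⟩

/-! ### From local boundedness to joint quasinearly subharmonicity -/

/-- Without integrability the left side is `0`, so the mean value inequalities can be iterated as
lower integrals before the integrability of any slice is known. -/
theorem ofReal_integral_le_lintegral {X : Type*} [MeasurableSpace X] {μ : Measure X} {f : X → ℝ}
    (hf : ∀ x, 0 ≤ f x) : ENNReal.ofReal (∫ x, f x ∂μ) ≤ ∫⁻ x, ENNReal.ofReal (f x) ∂μ := by
  by_cases h : Integrable f μ
  · exact (ofReal_integral_eq_lintegral_ofReal h (Eventually.of_forall hf)).le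
  · simp [integral_undef h]

theorem IsKQuasinearlySubharmonic.ofReal_trunc_le {N : ℕ} {K : ℝ} {D : Set (Eucl N)}
    {v : Eucl N → EReal} (hv : IsKQuasinearlySubharmonic K D v) {x : Eucl N} {r : ℝ} (hr : 0 < r)
    (hD : closedBall x r ⊆ D) {M : ℝ} (hM : 0 ≤ M) :
    ENNReal.ofReal (trunc v M x) ≤ ENNReal.ofReal (K / volume.real (ball x r)) *
      ∫⁻ y in ball x r, ENNReal.ofReal (trunc v M y) := by
  refine (ENNReal.ofReal_le_ofReal (hv.mean_value x r hr hD M hM)).trans ?_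
  rw [ENNReal.ofReal_mul (div_nonneg (zero_le_one.trans hv.one_le) measureReal_nonneg)]
  gcongr
  exact ofReal_integral_le_lintegral (trunc_nonneg v hM)

theorem integrableOn_trunc_of_le {N : ℕ} {D S : Set (Eucl N)} {u : Eucl N → EReal}
    (hum : AEMeasurable u (volume.restrict D)) (hS : MeasurableSet S) (hSf : volume S < ⊤)
    (hSD : S ⊆ D) {B : ℝ} (hB : ∀ z ∈ S, uplus u z ≤ B) {M : ℝ} (hM : 0 ≤ M) :
    IntegrableOn (trunc u M) S := by
  refine IntegrableOn.of_bound hSf (aemeasurable_trunc (hum.mono_measure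
    (Measure.restrict_mono_set _ hSD)) M).aestronglyMeasurable (B + M)
    (ae_restrict_of_forall_mem hS fun w hw => ?_)
  rw [Real.norm_of_nonneg (trunc_nonneg u hM w)]
  exact (trunc_le_uplus_add u hM w).trans (add_le_add_left (hB w hw) M)

theorem join_mem_ball {m n : ℕ} {x₀ x : Eucl m} {y₀ y : Eucl n} {r : ℝ}
    (hx : x ∈ ball x₀ (r / 2)) (hy : y ∈ ball y₀ (r / 2)) : join x y ∈ ball (join x₀ y₀) r := by
  rw [mem_ball] at *
  linarith [dist_join_le x x₀ y y₀]

theorem join_mem_closedBall {m n : ℕ} {x₀ x : Eucl m} {y₀ y : Eucl n} {r : ℝ}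
    (hx : x ∈ closedBall x₀ (r / 2)) (hy : y ∈ closedBall y₀ (r / 2)) :
    join x y ∈ closedBall (join x₀ y₀) r := by
  rw [mem_closedBall] at *
  linarith [dist_join_le x x₀ y y₀]

/-- A separately quasinearly subharmonic function that is locally bounded above is quasinearly
subharmonic. -/
theorem isQuasinearlySubharmonic_of_locally_bounded {m n : ℕ} {K : ℝ} (hK : 1 ≤ K)
    {Ω : Set (Eucl (m + n))} (hΩ : IsOpen Ω) {u : Eucl (m + n) → EReal} (hu : ∀ z ∈ Ω, u z < ⊤)
    (hum : AEMeasurable u (volume.restrict Ω))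
    (ha : ∀ y : Eucl n, IsKQuasinearlySubharmonic K
      {x : Eucl m | join x y ∈ Ω} (fun x => u (join x y)))
    (hb : ∀ x : Eucl m, IsKQuasinearlySubharmonic K
      {y : Eucl n | join x y ∈ Ω} (fun y => u (join x y)))
    (hbdd : ∀ z ∈ Ω, ∃ δ > 0, ∃ B, ∀ z' ∈ ball z δ, uplus u z' ≤ B) :
    IsQuasinearlySubharmonic Ω u := by
  have hνm := volume_real_unitBall_pos m
  have hνn := volume_real_unitBall_pos n
  have hνN := volume_real_unitBall_pos (m + n)
  set νm := volume.real (ball (0 : Eucl m) 1) with hνm'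
  set νn := volume.real (ball (0 : Eucl n) 1) with hνn'
  set νN := volume.real (ball (0 : Eucl (m + n)) 1) with hνN'
  -- Two factors `K`, the ratio of the volume of the `r`-ball to that of the product of two
  -- `r/2`-balls, and a maximum to have a constant at least `1`.
  refine ⟨max 1 (K ^ 2 * 2 ^ (m + n) * νN / (νm * νn)), le_max_left _ _, hu, hum, ?_, ?_⟩
  · intro z hz
    obtain ⟨δ, hδ, B, hB⟩ := hbdd z hz
    refine ⟨Ω ∩ ball z δ, inter_mem_nhdsWithin _ (ball_mem_nhds z hδ), ?_⟩
    rw [← trunc_zero]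
    exact integrableOn_trunc_of_le hum (hΩ.measurableSet.inter measurableSet_ball)
      ((measure_mono Set.inter_subset_right).trans_lt measure_ball_lt_top) Set.inter_subset_left
      (fun w hw => hB w hw.2) le_rfl
  · intro z r hr hzr M hM
    obtain ⟨x, y, rfl⟩ := exists_join_eq z
    obtain ⟨B, hB⟩ := exists_uplus_le_of_isCompact (isCompact_closedBall (join x y) r)
      fun z' hz' => hbdd z' (hzr hz')
    set I := ∫ w in ball (join x y) r, trunc u M w with hI
    have hint : IntegrableOn (trunc u M) (ball (join x y) r) :=
      integrableOn_trunc_of_le hum measurableSet_ball measure_ball_lt_top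
        (ball_subset_closedBall.trans hzr) (fun w hw => hB w (ball_subset_closedBall hw)) hM
    have hr2 : 0 < r / 2 := by positivity
    have hImg : (fun p : Eucl m × Eucl n => join p.1 p.2) '' ball x (r / 2) ×ˢ ball y (r / 2) ⊆
        ball (join x y) r := by
      rintro _ ⟨p, hp, rfl⟩
      exact join_mem_ball hp.1 hp.2
    set a := K / volume.real (ball x (r / 2)) with ha'
    set b := K / volume.real (ball y (r / 2)) with hb'
    have ha0 : 0 ≤ a := div_nonneg (by linarith) measureReal_nonneg
    have hb0 : 0 ≤ b := div_nonneg (by linarith) measureReal_nonneg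
    have hI0 : 0 ≤ I := integral_nonneg fun w => trunc_nonneg u hM w
    have key : ENNReal.ofReal (trunc u M (join x y)) ≤ ENNReal.ofReal (a * (b * I)) := by
      calc ENNReal.ofReal (trunc u M (join x y))
          ≤ ENNReal.ofReal a * ∫⁻ x' in ball x (r / 2), ENNReal.ofReal (trunc u M (join x' y)) :=
            (ha y).ofReal_trunc_le hr2
              (fun x' hx' => hzr (join_mem_closedBall hx' (mem_closedBall_self hr2.le))) hM
        _ ≤ ENNReal.ofReal a * ∫⁻ x' in ball x (r / 2), ENNReal.ofReal b *
              ∫⁻ y' in ball y (r / 2), ENNReal.ofReal (trunc u M (join x' y')) := by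
            gcongr ENNReal.ofReal a * ?_
            refine setLIntegral_mono' measurableSet_ball fun x' hx' => ?_
            exact (hb x').ofReal_trunc_le hr2
              (fun y' hy' => hzr (join_mem_closedBall (ball_subset_closedBall hx') hy')) hM
        _ = ENNReal.ofReal a * (ENNReal.ofReal b *
              ∫⁻ w in (fun p : Eucl m × Eucl n => join p.1 p.2) '' ball x (r / 2) ×ˢ ball y (r / 2),
                ENNReal.ofReal (trunc u M w)) := by
            rw [lintegral_const_mul' _ _ ENNReal.ofReal_ne_top,
              ← lintegral_join (hint.mono_set hImg).aemeasurable.ennreal_ofReal]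
        _ ≤ ENNReal.ofReal a * (ENNReal.ofReal b *
              ∫⁻ w in ball (join x y) r, ENNReal.ofReal (trunc u M w)) := by
            gcongr
        _ = _ := by
            rw [ENNReal.ofReal_mul ha0, ENNReal.ofReal_mul hb0, hI,
              ofReal_integral_eq_lintegral_ofReal hint
                (Eventually.of_forall (trunc_nonneg u hM))]
    rw [ENNReal.ofReal_le_ofReal_iff (by positivity)] at key
    refine key.trans ?_
    rw [← mul_assoc]
    refine mul_le_mul_of_nonneg_right ?_ hI0
    rw [ha', hb', volume_real_ball _ hr2, volume_real_ball _ hr2, volume_real_ball _ hr,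
      ← hνm', ← hνn', ← hνN']
    calc K / ((r / 2) ^ m * νm) * (K / ((r / 2) ^ n * νn))
        = K ^ 2 * 2 ^ (m + n) * νN / (νm * νn) / (r ^ (m + n) * νN) := by
          rw [div_pow, div_pow, pow_add, pow_add]
          field_simp
      _ ≤ _ := by
          gcongr
          exact le_max_right _ _

end QNS

theorem corollary4p3 (m n : ℕ) (hn : 2 ≤ n) (hmn : n ≤ m) (K : ℝ) (hK : 1 ≤ K)
    (Ω : Set (QNS.Eucl (m + n))) (hΩ : IsOpen Ω) (hΩc : IsConnected Ω)
    (u : QNS.Eucl (m + n) → EReal) (hu : ∀ z ∈ Ω, u z < ⊤)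
    (hum : AEMeasurable u (volume.restrict Ω))
    (ha : ∀ y : QNS.Eucl n, QNS.IsKQuasinearlySubharmonic K
      {x : QNS.Eucl m | QNS.join x y ∈ Ω} (fun x => u (QNS.join x y)))
    (hb : ∀ x : QNS.Eucl m, QNS.IsKQuasinearlySubharmonic K
      {y : QNS.Eucl n | QNS.join x y ∈ Ω} (fun y => u (QNS.join x y)))
    (φ ϕ : ℝ≥0 ≃o ℝ≥0) (s₀ s₁ : ℕ) (hs : s₀ < s₁)
    (hc1 : ∀ s : ℝ, (s₁ : ℝ) ≤ s →
      2 * K * (ϕ.symm (Real.exp (s - s₀)).toNNReal : ℝ) ≤ (ϕ.symm (Real.exp s).toNNReal : ℝ))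
    (hc2 : QNS.DeltaTwo ϕ.symm)
    (hc3 : IntegrableOn
      (fun s : ℝ => s ^ (((n : ℝ) - 1) / ((m : ℝ) - 1)) /
        (φ (s - s₀).toNNReal : ℝ) ^ (1 / ((m : ℝ) - 1)))
      (Set.Ioi (s₁ : ℝ)) volume)
    (hc4 : LocallyIntegrableOn
      (fun z => (φ (Real.posLog (ϕ (QNS.uplus u z).toNNReal : ℝ)).toNNReal : ℝ)) Ω volume) :
    QNS.IsQuasinearlySubharmonic Ω u := by
  refine QNS.isQuasinearlySubharmonic_of_locally_bounded hK hΩ hu hum ha hb fun z hz => ?_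
  -- Lowering both dimensions by one turns the exponents of (c3) into `n / m` and `1 / m`.
  obtain ⟨m, rfl⟩ : ∃ k, m = k + 1 := ⟨m - 1, by omega⟩
  obtain ⟨n, rfl⟩ : ∃ k, n = k + 1 := ⟨n - 1, by omega⟩
  push_cast at hc3
  simp only [add_sub_cancel_right] at hc3
  exact QNS.uplus_bounded_nhds (by omega) (by omega) hK hΩ ha hb φ ϕ s₀ s₁ hc1 hc2 hc3 hc4 hz
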